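/- Let $M=\langle\mathcal S,\mathcal A,p,\gamma,r,\rho\rangle$ be a Markov decision process with finite state space $\mathcal S$, finite action space $\mathcal A$, transition probabilities $p(s'\mid s,a)$, discount factor $\gamma\in(0,1)$ and initial state distribution $\rho$, and let $\pi$ be a stationary policy. Let $(S_0,A_0,S_1,A_1,\dots)$ be the trajectory with $S_0\sim\rho$, $A_t\sim\pi(\cdot\mid S_t)$ and $S_{t+1}\sim p(\cdot\mid S_t,A_t)$. Let $\mathbb E_\pi[\tau_s^+(s)]$ be the expected value of the first time $t>0$ with $S_t=s$ (set to $\infty$ if there is none) when the process is started in $S_0=s$ instead; the state $s$ is positive recurrent if $\mathbb E_\pi[\tau_s^+(s)]<\infty$. Write $p_\pi(s'\mid s)=\sum_{a}\pi(a\mid s)\,p(s'\mid s,a)$, and let the discounted stationary state distribution $d_{\pi,\gamma}$ be the probability distribution on $\mathcal S$ satisfying $$\sum_{s\in\mathcal S}d_{\pi,\gamma}(s)\bigl[\gamma\,p_\pi(s'\mid s)+(1-\gamma)\rho(s')\bigr]=d_{\pi,\gamma}(s')\qquad\text{for all } s'\in\mathcal S .$$ For $T\in\mathbb N$ put $$c_{\pi,T}(s)=\mathbb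 E\left[(1-\gamma)\,T\,\frac{\sum_{t=0}^{T-1}\gamma^t\,\mathbf 1[S_t=s]}{\sum_{k=0}^{T-1}\mathbf 1[S_k=s]}\right],$$ where the quotient is read as $0$ on trajectories that do not visit $s$ before time $T$. Then for every positive recurrent state $s$: the distribution $d_{\pi,\gamma}$ exists and is unique, the limit $c_\pi(s)=\lim_{T\to\infty}c_{\pi,T}(s)$ exists, and $$c_\pi(s)=\mathbb E_\pi[\tau_s^+(s)]\;d_{\pi,\gamma}(s)\;\le\;\mathbb E_\pi[\tau_s^+(s)]<\infty .$$ -/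

import Mathlib

open MeasureTheory ProbabilityTheory Filter Topology
open scoped ENNReal

/-- A Markov decision process with state space `S`, action space `A`, transition probabilities
`p s a s' = p(s' | s, a)`, discount factor `γ ∈ (0, 1)`, expected rewards `r` and initial state
distribution `ρ`. -/
structure MDP (S A : Type*) where
  p : S → A → PMF S
  γ : ℝ
  γ_pos : 0 < γ
  γ_lt_one : γ < 1
  r : S → A → ℝ
  ρ : PMF S

/-- A stationary policy: `π s a = π(a | s)`. -/
abbrev Policy (S A : Type*) := S → PMF A

noncomputable section

namespace MDP

variable {S A : Type*} [Fintype S] [MeasurableSpace S] [MeasurableSingletonClass S]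
  [Fintype A] [MeasurableSpace A] [MeasurableSingletonClass A]

/-- The law of a pair `(S, A)` with `S ∼ μ` and `A ∼ π(· | S)`. -/
def pairPMF {S A : Type*} (π : Policy S A) (μ : PMF S) : PMF (S × A) :=
  μ.bind fun s => (π s).map fun a => (s, a)

/-- One step of the state-action process: from `(s, a)` draw `s' ∼ p(· | s, a)` and then
`a' ∼ π(· | s')`. -/
def stepKernel (M : MDP S A) (π : Policy S A) : Kernel (S × A) (S × A) :=
  Kernel.ofFunOfCountable fun x => (pairPMF π (M.p x.1 x.2)).toMeasure

instance (M : MDP S A) (π : Policy S A) : IsMarkovKernel (M.stepKernel π) :=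
  ⟨fun x => inferInstanceAs (IsProbabilityMeasure (pairPMF π (M.p x.1 x.2)).toMeasure)⟩

/-- The one-step kernel as a function of the history `(S₀, A₀), …, (Sₙ, Aₙ)`; it only uses the
last pair. -/
def historyKernel (M : MDP S A) (π : Policy S A) (n : ℕ) :
    Kernel ((i : Finset.Iic n) → (fun _ : ℕ => S × A) i) (S × A) :=
  (M.stepKernel π).comap (fun h => h ⟨n, Finset.mem_Iic.2 le_rfl⟩) (measurable_pi_apply _)

instance (M : MDP S A) (π : Policy S A) (n : ℕ) : IsMarkovKernel (M.historyKernel π n) :=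
  inferInstanceAs (IsMarkovKernel (Kernel.comap _ _ _))

/-- The law of the infinite trajectory `(S₀, A₀, S₁, A₁, …)` with `S₀ ∼ μ`, `Aₜ ∼ π(· | Sₜ)` and
`Sₜ₊₁ ∼ p(· | Sₜ, Aₜ)`. -/
def trajLaw (M : MDP S A) (π : Policy S A) (μ : PMF S) : Measure (ℕ → S × A) :=
  Kernel.trajMeasure (X := fun _ => S × A) (pairPMF π μ).toMeasure (M.historyKernel π)

/-- The state transition probability `p_π(s' | s) = ∑ₐ π(a | s) p(s' | s, a)`. -/
def transProb {S A : Type*} [Fintype A] (M : MDP S A) (π : Policy S A) (s s' : S) : ℝ :=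
  ∑ a, (π s a).toReal * (M.p s a s').toReal

/-- `d` is a discounted stationary state distribution: a probability vector with
`∑ₛ d(s) [γ p_π(s' | s) + (1 - γ) ρ(s')] = d(s')` for all `s'`. -/
structure IsDiscountedStationary {S A : Type*} [Fintype S] [Fintype A] (M : MDP S A)
    (π : Policy S A) (d : S → ℝ) : Prop where
  nonneg : ∀ s, 0 ≤ d s
  sum_eq_one : ∑ s, d s = 1
  stationary : ∀ s', ∑ s, d s * (M.γ * M.transProb π s s' + (1 - M.γ) * (M.ρ s').toReal) = d s'

/-- The first time `t > 0` at which the trajectory is in state `s` (`∞` if there is none). -/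
def returnTime {S A : Type*} (s : S) (ω : ℕ → S × A) : ℝ≥0∞ :=
  ⨅ (t : ℕ) (_ : 0 < t ∧ (ω t).1 = s), (t : ℝ≥0∞)

/-- The expected recurrence time `E_π[τ_s⁺(s)]`: the expected time of the first return to `s` of
the process that starts in `S₀ = s`. -/
def expectedRecurrenceTime (M : MDP S A) (π : Policy S A) (s : S) : ℝ≥0∞ :=
  ∫⁻ ω, returnTime s ω ∂(M.trajLaw π (PMF.pure s))

/-- A state is positive recurrent if its expected recurrence time is finite. -/
def IsPositiveRecurrent (M : MDP S A) (π : Policy S A) (s : S) : Prop :=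
  M.expectedRecurrenceTime π s < ∞

/-- The indicator `1[Sₜ = s]` of a trajectory. -/
def visit {S A : Type*} (s : S) (t : ℕ) (ω : ℕ → S × A) : ℝ :=
  Set.indicator {ω' : ℕ → S × A | (ω' t).1 = s} 1 ω

/-- The average of `γ ^ t` over the times `t < T` at which the trajectory visits `s`
(`0` if there is no such time). -/
def trajAverage {S A : Type*} (M : MDP S A) (T : ℕ) (s : S) (ω : ℕ → S × A) : ℝ :=
  (∑ t ∈ Finset.range T, M.γ ^ t * visit s t ω) / ∑ k ∈ Finset.range T, visit s k ω

/-- The averaging correction with horizon `T`: the expectation of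
`(1 - γ) T ·` (average of `γ ^ t` over visits to `s`) over trajectories with `S₀ ∼ ρ`. -/
def averagingCorrection (M : MDP S A) (π : Policy S A) (T : ℕ) (s : S) : ℝ :=
  ∫ ω, (1 - M.γ) * T * M.trajAverage T s ω ∂(M.trajLaw π M.ρ)

end MDP

end

namespace MDP

/-! Exchanging sum and expectation gives `c_T(s) = (1 - γ) ∑_{t<T} γ^t E[1[S_t = s] T / N_T]`, where
`N_T` counts the visits to `s` before `T`. If each expectation tends to `L · P(S_t = s)`, with `L`
the expected return time, and does so with an error bounded by a constant times `1 + t`, then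
dominated convergence against `γ^t` yields the limit `L (1 - γ) ∑ γ^t P(S_t = s)`. The discounted
occupation measure is the stationary distribution, so this is `L d(s)`.

The inverse frequency is controlled by a Poisson equation, without renewal theory. Let `h(y)` be the
expected hitting time of `s`, with `h(s) = 0`. On the states with finite expected return time to
`s`, first-step analysis gives `P h = h - 1 + L 1_s`. Two consequences hold on paths with `S_t = s`,
where `N` counts the visits in the next `n` time steps: (1) `h(S_{t+n}) + n - L N` is a martingale
with bounded increments, so its second moment is `O(n)` (`stateExp_compensated_sq_le`); (2) `1 + h`
is a Lyapunov function, so `E[exp(-β N)]` decays geometrically for a suitable `β`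
(`stateExp_exp_visCount_le`), and `N` is rarely below a fixed fraction of `n`. By (1) the numerator
of `T / N_T - L = (T - L N_T) / N_T` is of order `√n` up to a term linear in `t`, and by (2) the
denominator is of order `n`. The rare event with few visits contributes an exponentially small
amount (`abs_div_sub_le`, `exists_rate`). -/

theorem pairPMF_apply {S A : Type*} (π : Policy S A) (ν : PMF S) (s : S) (a : A) :
    pairPMF π ν (s, a) = ν s * π s a := by
  classical
  simp only [pairPMF, PMF.bind_apply, PMF.map_apply, Prod.mk.injEq]
  rw [tsum_eq_single s]
  · congr 1
    rw [tsum_eq_single a]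
    · simp
    · intro b hb
      simp [hb.symm]
  · intro b hb
    simp [hb.symm]

theorem sum_toReal_pmf {α : Type*} [Fintype α] (p : PMF α) : ∑ a, (p a).toReal = 1 := by
  rw [← ENNReal.toReal_sum fun a _ => p.apply_ne_top a, ← tsum_fintype (L := .unconditional α), p.tsum_coe,
    ENNReal.toReal_one]

/-- Freezing the path at time `n` exhibits `F` as a function of a finite history. Over finite spaces
such functions are automatically measurable and integrable. -/
theorem dependsOn_apply_min {S : Type*} {F : (ℕ → S) → ℝ} {n : ℕ} (hF : DependsOn F (Set.Iic n))
    (x : ℕ → S) : F x = F (fun k => x (min k n)) :=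
  hF fun k hk => by rw [min_eq_left (Set.mem_Iic.1 hk)]

theorem transProb_nonneg {S A : Type*} [Fintype A] (M : MDP S A) (π : Policy S A) (x y : S) : 0 ≤ M.transProb π x y :=
  Finset.sum_nonneg fun _ _ => mul_nonneg ENNReal.toReal_nonneg ENNReal.toReal_nonneg

theorem sum_transProb {S A : Type*} [Fintype S] [Fintype A] (M : MDP S A) (π : Policy S A) (x : S) : ∑ y, M.transProb π x y = 1 := by
  simp only [transProb]
  rw [Finset.sum_comm]
  simp only [← Finset.mul_sum, sum_toReal_pmf, mul_one]

/-! ### The state process and its Markov property -/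

section StateProcess

variable {S A : Type*} [Fintype S] [MeasurableSpace S] [MeasurableSingletonClass S]
  [Fintype A] [MeasurableSpace A] [MeasurableSingletonClass A]

instance (M : MDP S A) (π : Policy S A) (ν : PMF S) : IsProbabilityMeasure (M.trajLaw π ν) :=
  inferInstanceAs (IsProbabilityMeasure (Kernel.trajMeasure _ _))

theorem integral_pairPMF (π : Policy S A) (ν : PMF S) (k : S × A → ℝ) :
    ∫ z, k z ∂(pairPMF π ν).toMeasure =
      ∑ s, (ν s).toReal * ∑ a, (π s a).toReal * k (s, a) := by
  rw [PMF.integral_eq_sum, Fintype.sum_prod_type]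
  refine Finset.sum_congr rfl fun s _ => ?_
  rw [Finset.mul_sum]
  refine Finset.sum_congr rfl fun a _ => ?_
  rw [pairPMF_apply, ENNReal.toReal_mul, smul_eq_mul, mul_assoc]

theorem integrable_comp_frestrictLe (M : MDP S A) (π : Policy S A) (ν : PMF S) (n : ℕ)
    (G : ((i : Finset.Iic n) → (fun _ : ℕ => S × A) i) → ℝ) :
    Integrable (fun ω => G (Preorder.frestrictLe n ω)) (M.trajLaw π ν) := by
  have hm : Measurable G := Measurable.of_discrete
  have : Integrable G ((M.trajLaw π ν).map (Preorder.frestrictLe n)) := by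
    have : IsProbabilityMeasure ((M.trajLaw π ν).map
        (Preorder.frestrictLe (π := fun _ : ℕ => S × A) n)) :=
      Measure.isProbabilityMeasure_map (by fun_prop)
    exact Integrable.of_finite
  exact this.comp_measurable (by fun_prop)

/-- The joint law of the history and the next pair is the composition-product of the law of the
history with the one-step kernel. -/
theorem integral_trajLaw_succ (M : MDP S A) (π : Policy S A) (ν : PMF S) (n : ℕ)
    (G : ((i : Finset.Iic n) → (fun _ : ℕ => S × A) i) → S × A → ℝ) :
    ∫ ω, G (Preorder.frestrictLe n ω) (ω (n + 1)) ∂(M.trajLaw π ν) =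
      ∫ ω, ∫ z, G (Preorder.frestrictLe n ω) z
        ∂(pairPMF π (M.p (ω n).1 (ω n).2)).toMeasure ∂(M.trajLaw π ν) := by
  have key := Kernel.map_frestrictLe_trajMeasure_compProd_eq_map_trajMeasure
    (X := fun _ => S × A) (μ₀ := (pairPMF π ν).toMeasure) (κ := M.historyKernel π) (a := n)
  have hprob : IsProbabilityMeasure ((M.trajLaw π ν).map
      (Preorder.frestrictLe (π := fun _ : ℕ => S × A) n)) :=
    Measure.isProbabilityMeasure_map (by fun_prop)
  change (M.trajLaw π ν).map _ ⊗ₘ _ = (M.trajLaw π ν).map _ at key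
  have hG : Measurable (Function.uncurry G) := Measurable.of_discrete
  have h1 : ∫ ω, G (Preorder.frestrictLe n ω) (ω (n + 1)) ∂(M.trajLaw π ν) =
      ∫ q, Function.uncurry G q ∂((M.trajLaw π ν).map
        fun x => (Preorder.frestrictLe n x, x (n + 1))) := by
    rw [integral_map (by fun_prop) hG.aestronglyMeasurable]
    rfl
  rw [h1, ← key, Measure.integral_compProd Integrable.of_finite, integral_map (by fun_prop)
    (Measurable.of_discrete.aestronglyMeasurable)]
  rfl

theorem integral_trajLaw_zero (M : MDP S A) (π : Policy S A) (ν : PMF S) (k : S × A → ℝ) :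
    ∫ ω, k (ω 0) ∂(M.trajLaw π ν) = ∫ z, k z ∂(pairPMF π ν).toMeasure := by
  have key : (M.trajLaw π ν).map (Preorder.frestrictLe (π := fun _ : ℕ => S × A) 0) =
      (pairPMF π ν).toMeasure.map
        (MeasurableEquiv.piUnique (fun i : Finset.Iic 0 => (fun _ : ℕ => S × A) i)).symm := by
    rw [trajLaw, Kernel.trajMeasure, Measure.map_comp _ _ (by fun_prop),
      Kernel.traj_map_frestrictLe, Kernel.partialTraj_self, Measure.id_comp]
  have hk : Measurable k := Measurable.of_discrete
  have h1 : ∫ ω, k (ω 0) ∂(M.trajLaw π ν) = ∫ u, k (u ⟨0, Finset.mem_Iic.2 le_rfl⟩)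
      ∂((M.trajLaw π ν).map (Preorder.frestrictLe (π := fun _ : ℕ => S × A) 0)) := by
    rw [integral_map (by fun_prop) (Measurable.of_discrete.aestronglyMeasurable)]
    rfl
  rw [h1, key, integral_map (by fun_prop) (Measurable.of_discrete.aestronglyMeasurable)]
  rfl

/-- The expectation of a function of the state process `(S₀, S₁, …)` with `S₀ ∼ ν`. -/
noncomputable def stateExp (M : MDP S A) (π : Policy S A) (ν : PMF S) (F : (ℕ → S) → ℝ) : ℝ :=
  ∫ ω, F (fun t => (ω t).1) ∂(M.trajLaw π ν)

theorem integrable_of_dependsOn (M : MDP S A) (π : Policy S A) (ν : PMF S) {F : (ℕ → S) → ℝ}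
    {n : ℕ} (hF : DependsOn F (Set.Iic n)) :
    Integrable (fun ω => F (fun t => (ω t).1)) (M.trajLaw π ν) := by
  have h := M.integrable_comp_frestrictLe π ν n
    (fun u => F (fun k => (u ⟨min k n, Finset.mem_Iic.2 (min_le_right _ _)⟩).1))
  refine h.congr (ae_of_all _ fun ω => ?_)
  exact (dependsOn_apply_min hF fun t => (ω t).1).symm

theorem integral_pairPMF_average (π : Policy S A) (ν : PMF S) (Φ : S → ℝ) (k : S × A → ℝ) :
    ∫ z, Φ z.1 * k z ∂(pairPMF π ν).toMeasure =
      ∫ z, Φ z.1 * ∑ a, (π z.1 a).toReal * k (z.1, a) ∂(pairPMF π ν).toMeasure := by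
  rw [integral_pairPMF, integral_pairPMF]
  refine Finset.sum_congr rfl fun s _ => ?_
  dsimp only
  rw [← Finset.sum_mul, sum_toReal_pmf, one_mul]
  simp only [Finset.mul_sum]
  refine Finset.sum_congr rfl fun a _ => ?_
  ring

/-- Given the states up to time `n`, the action at time `n` is distributed according to `π`. -/
theorem integral_average_action (M : MDP S A) (π : Policy S A) (ν : PMF S)
    {F : (ℕ → S) → ℝ} {n : ℕ} (hF : DependsOn F (Set.Iic n)) (k : S × A → ℝ) :
    ∫ ω, F (fun t => (ω t).1) * k (ω n) ∂(M.trajLaw π ν) =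
      ∫ ω, F (fun t => (ω t).1) * ∑ a, (π (ω n).1 a).toReal * k ((ω n).1, a)
        ∂(M.trajLaw π ν) := by
  cases n with
  | zero =>
    have h0 : ∀ ω : ℕ → S × A, F (fun t => (ω t).1) = F (fun _ => (ω 0).1) := fun ω => by
      rw [dependsOn_apply_min hF]
      simp
    simp only [h0]
    rw [M.integral_trajLaw_zero π ν (fun z => F (fun _ => z.1) * k z),
      M.integral_trajLaw_zero π ν
        (fun z => F (fun _ => z.1) * ∑ a, (π z.1 a).toReal * k (z.1, a))]
    exact integral_pairPMF_average π ν (fun y => F fun _ => y) k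
  | succ n =>
    -- `Ψ` separates the state at time `n + 1` from the earlier history, so that the last pair can
    -- be integrated out with the history fixed.
    let Ψ : ((i : Finset.Iic n) → (fun _ : ℕ => S × A) i) → S → ℝ := fun u y =>
      F (fun j => if j ≤ n then (u ⟨min j n, Finset.mem_Iic.2 (min_le_right _ _)⟩).1 else y)
    have h0 : ∀ ω : ℕ → S × A,
        F (fun t => (ω t).1) = Ψ (Preorder.frestrictLe n ω) (ω (n + 1)).1 := fun ω => by
      refine hF fun j hj => ?_
      by_cases hjn : j ≤ n
      · simp [hjn]
      · have : j = n + 1 := le_antisymm hj (by omega)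
        simp [this]
    simp only [h0]
    rw [M.integral_trajLaw_succ π ν n (fun u z => Ψ u z.1 * k z),
      M.integral_trajLaw_succ π ν n
        (fun u z => Ψ u z.1 * ∑ a, (π z.1 a).toReal * k (z.1, a))]
    exact integral_congr_ae (ae_of_all _ fun ω =>
      integral_pairPMF_average π _ (Ψ (Preorder.frestrictLe n ω)) k)

/-- The Markov property of the state process. -/
theorem stateExp_mul_succ (M : MDP S A) (π : Policy S A) (ν : PMF S)
    {F : (ℕ → S) → ℝ} {n : ℕ} (hF : DependsOn F (Set.Iic n)) (g : S → ℝ) :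
    M.stateExp π ν (fun x => F x * g (x (n + 1))) =
      M.stateExp π ν (fun x => F x * ∑ y, M.transProb π (x n) y * g y) := by
  have h0 : ∀ ω : ℕ → S × A, F (fun t => (ω t).1) =
      F (fun k => (Preorder.frestrictLe (π := fun _ : ℕ => S × A) n ω
        ⟨min k n, Finset.mem_Iic.2 (min_le_right _ _)⟩).1) := fun ω =>
    dependsOn_apply_min hF fun t => (ω t).1
  have h1 := M.integral_trajLaw_succ π ν n (fun u z =>
    F (fun k => (u ⟨min k n, Finset.mem_Iic.2 (min_le_right _ _)⟩).1) * g z.1)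
  simp only [← h0] at h1
  have h2 : ∀ z : S × A, ∫ w, g w.1 ∂(pairPMF π (M.p z.1 z.2)).toMeasure =
      ∑ y, (M.p z.1 z.2 y).toReal * g y := fun z => by
    rw [integral_pairPMF]
    refine Finset.sum_congr rfl fun y _ => ?_
    dsimp only
    rw [← Finset.sum_mul, sum_toReal_pmf, one_mul]
  simp only [integral_const_mul, h2] at h1
  unfold stateExp
  -- The transition law still involves the action at time `n`; averaging that action over `π` turns
  -- `p` into `p_π`.
  rw [h1, M.integral_average_action π ν hF
    (fun z => ∑ y, (M.p z.1 z.2 y).toReal * g y)]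
  refine integral_congr_ae (ae_of_all _ fun ω => ?_)
  simp only [transProb, Finset.sum_mul, Finset.mul_sum]
  rw [Finset.sum_comm]
  refine Finset.sum_congr rfl fun y _ => Finset.sum_congr rfl fun a _ => ?_
  ring

theorem stateExp_zero_apply (M : MDP S A) (π : Policy S A) (ν : PMF S) (g : S → ℝ) :
    M.stateExp π ν (fun x => g (x 0)) = ∑ y, (ν y).toReal * g y := by
  unfold stateExp
  rw [M.integral_trajLaw_zero π ν fun z => g z.1, integral_pairPMF]
  refine Finset.sum_congr rfl fun y _ => ?_
  dsimp only
  rw [← Finset.sum_mul, sum_toReal_pmf, one_mul]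

theorem stateExp_const (M : MDP S A) (π : Policy S A) (ν : PMF S) (c : ℝ) :
    M.stateExp π ν (fun _ => c) = c := by
  simp [stateExp]

theorem stateExp_const_mul (M : MDP S A) (π : Policy S A) (ν : PMF S) (c : ℝ)
    (F : (ℕ → S) → ℝ) : M.stateExp π ν (fun x => c * F x) = c * M.stateExp π ν F :=
  integral_const_mul _ _

theorem stateExp_nonneg (M : MDP S A) (π : Policy S A) (ν : PMF S) {F : (ℕ → S) → ℝ}
    (hF : ∀ x, 0 ≤ F x) : 0 ≤ M.stateExp π ν F :=
  integral_nonneg fun _ => hF _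

theorem stateExp_add (M : MDP S A) (π : Policy S A) (ν : PMF S) {F G : (ℕ → S) → ℝ} {n : ℕ}
    (hF : DependsOn F (Set.Iic n)) (hG : DependsOn G (Set.Iic n)) :
    M.stateExp π ν (fun x => F x + G x) = M.stateExp π ν F + M.stateExp π ν G :=
  integral_add (M.integrable_of_dependsOn π ν hF) (M.integrable_of_dependsOn π ν hG)

theorem stateExp_sub (M : MDP S A) (π : Policy S A) (ν : PMF S) {F G : (ℕ → S) → ℝ} {n : ℕ}
    (hF : DependsOn F (Set.Iic n)) (hG : DependsOn G (Set.Iic n)) :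
    M.stateExp π ν (fun x => F x - G x) = M.stateExp π ν F - M.stateExp π ν G :=
  integral_sub (M.integrable_of_dependsOn π ν hF) (M.integrable_of_dependsOn π ν hG)

theorem stateExp_sum (M : MDP S A) (π : Policy S A) (ν : PMF S) {ι : Type*} (I : Finset ι)
    {F : ι → (ℕ → S) → ℝ} {n : ℕ} (hF : ∀ i ∈ I, DependsOn (F i) (Set.Iic n)) :
    M.stateExp π ν (fun x => ∑ i ∈ I, F i x) = ∑ i ∈ I, M.stateExp π ν (F i) :=
  integral_finsetSum I fun i hi => M.integrable_of_dependsOn π ν (hF i hi)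

theorem stateExp_mono (M : MDP S A) (π : Policy S A) (ν : PMF S) {F G : (ℕ → S) → ℝ} {n : ℕ}
    (hF : DependsOn F (Set.Iic n)) (hG : DependsOn G (Set.Iic n)) (h : ∀ x, F x ≤ G x) :
    M.stateExp π ν F ≤ M.stateExp π ν G :=
  integral_mono (M.integrable_of_dependsOn π ν hF) (M.integrable_of_dependsOn π ν hG)
    fun _ => h _

end StateProcess

/-- `P` is a matrix with a function `h` which solves the Poisson equation
`P h = h - 1 + L • 1_s` on a set `R` that contains `s` and is closed under `P`. -/
structure IsReturnPotential {S : Type*} [Fintype S] [DecidableEq S] (P : S → S → ℝ) (s : S)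
    (L : ℝ) (R : Set S) (h : S → ℝ) : Prop where
  mem : s ∈ R
  closed : ∀ x ∈ R, ∀ y, P x y ≠ 0 → y ∈ R
  nonneg : ∀ y, 0 ≤ h y
  apply_self : h s = 0
  poisson : ∀ x ∈ R, ∑ y, P x y * h y = h x - 1 + L * (if x = s then 1 else 0)
  one_le : 1 ≤ L

/-! ### Avoidance probabilities and the Poisson equation -/

section Survival

variable {S : Type*} [Fintype S] [DecidableEq S]

/-- `survival P s n x` is the probability that the chain with transition matrix `P` that starts
in `x` does not visit `s` at the times `1, …, n`. -/
def survival (P : S → S → ℝ) (s : S) : ℕ → S → ℝ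
  | 0, _ => 1
  | n + 1, x => ∑ y, P x y * (if y = s then 0 else survival P s n y)

theorem survival_nonneg {P : S → S → ℝ} (hP : ∀ x y, 0 ≤ P x y) (s : S) (n : ℕ) (x : S) :
    0 ≤ survival P s n x := by
  induction n generalizing x with
  | zero => simp [survival]
  | succ n ih =>
    refine Finset.sum_nonneg fun y _ => mul_nonneg (hP x y) ?_
    split_ifs
    · exact le_rfl
    · exact ih y

/-- A first step to `y ≠ s` gives `P x y * survival P s n y ≤ survival P s (n + 1) x`, so
summability passes to the successors of `x`. -/
theorem summable_survival_of_ne_zero {P : S → S → ℝ} (hP : ∀ x y, 0 ≤ P x y) {s x y : S}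
    (hx : Summable fun n => survival P s n x) (hxy : P x y ≠ 0) (hys : y ≠ s) :
    Summable fun n => survival P s n y := by
  have hx' : Summable fun n => survival P s (n + 1) x :=
    (summable_nat_add_iff (f := fun n => survival P s n x) 1).2 hx
  have : Summable fun n => (P x y)⁻¹ * survival P s (n + 1) x := hx'.mul_left _
  refine Summable.of_nonneg_of_le (fun n => survival_nonneg hP s n y) (fun n => ?_) this
  have hpos : 0 < P x y := lt_of_le_of_ne (hP x y) (Ne.symm hxy)
  rw [le_inv_mul_iff₀ hpos]
  have := Finset.single_le_sum (f := fun z => P x z * (if z = s then 0 else survival P s n z))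
    (fun z _ => mul_nonneg (hP x z) (by
      split_ifs
      · exact le_rfl
      · exact survival_nonneg hP s n z)) (Finset.mem_univ y)
  simpa [hys, survival] using this

/-- The expected hitting times of `s` solve the Poisson equation on the set of states from which
the return time to `s` has finite expectation. -/
theorem isReturnPotential_tsum_survival {P : S → S → ℝ} (hP : ∀ x y, 0 ≤ P x y) {s : S}
    (hs : Summable fun n => survival P s n s) :
    IsReturnPotential P s (∑' n, survival P s n s) {x | Summable fun n => survival P s n x}
      (fun y => if y = s then 0 else ∑' n, survival P s n y) where
  mem := hs
  closed := by
    intro x hx y hxy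
    by_cases hys : y = s
    · rw [hys]
      exact hs
    exact summable_survival_of_ne_zero hP hx hxy hys
  nonneg := by
    intro y
    split_ifs
    · exact le_rfl
    · exact tsum_nonneg fun n => survival_nonneg hP s n y
  apply_self := if_pos rfl
  poisson := by
    intro x hx
    have h1 : ∀ y, HasSum (fun n => P x y * (if y = s then 0 else survival P s n y))
        (P x y * (if y = s then 0 else ∑' n, survival P s n y)) := by
      intro y
      by_cases hys : y = s
      · simp [hys, hasSum_zero]
      -- When `P x y = 0`, the series at `y` may diverge and its `tsum` then has the default value
      -- `0`; the zero factor makes this harmless.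
      by_cases hxy : P x y = 0
      · simp [hxy, hasSum_zero]
      simpa [hys] using (summable_survival_of_ne_zero hP hx hxy hys).hasSum.mul_left (P x y)
    have h2 : HasSum (fun n => survival P s (n + 1) x)
        (∑ y, P x y * (if y = s then 0 else ∑' n, survival P s n y)) :=
      hasSum_sum fun y _ => h1 y
    have h3 : ∑' n, survival P s n x = 1 +
        ∑ y, P x y * (if y = s then 0 else ∑' n, survival P s n y) := by
      -- First-step analysis: the term `n = 0` is the unit of time spent on the first step.
      rw [hx.tsum_eq_zero_add, h2.tsum_eq]
      rfl
    by_cases hxs : x = s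
    · subst hxs
      simp only [if_true]
      linarith
    · simp only [hxs, if_false]
      linarith
  one_le := by
    have := hs.le_tsum 0 fun n _ => survival_nonneg hP s n s
    simpa [survival] using this

end Survival

/-! ### The return time as a sum of tail indicators -/

section ReturnTime

variable {S A : Type*}

/-- This is the pathwise tail formula `τ = ∑ 1[τ > n]`: the product is the indicator of no visit at
the times `1, …, n`. Without any return both sides are infinite. -/
theorem returnTime_eq_tsum [DecidableEq S] (s : S) (ω : ℕ → S × A) :
    returnTime s ω =
      ∑' n : ℕ, ENNReal.ofReal (∏ k ∈ Finset.range n, if (ω (k + 1)).1 = s then 0 else 1) := by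
  classical
  have hprod : ∀ n, (∏ k ∈ Finset.range n, if (ω (k + 1)).1 = s then (0 : ℝ) else 1) =
      if ∃ k < n, (ω (k + 1)).1 = s then 0 else 1 := by
    intro n
    split_ifs with hn
    · obtain ⟨k, hk, hks⟩ := hn
      exact Finset.prod_eq_zero (Finset.mem_range.2 hk) (if_pos hks)
    · push Not at hn
      exact Finset.prod_eq_one fun k hk => if_neg (hn k (Finset.mem_range.1 hk))
  simp only [hprod]
  by_cases hex : ∃ k, (ω (k + 1)).1 = s
  · have hmin : ∀ n, (∃ k < n, (ω (k + 1)).1 = s) ↔ Nat.find hex < n := fun n =>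
      ⟨fun ⟨k, hk, hks⟩ => (Nat.find_min' hex hks).trans_lt hk,
        fun hn => ⟨_, hn, Nat.find_spec hex⟩⟩
    simp only [hmin]
    rw [tsum_eq_sum (s := Finset.range (Nat.find hex + 1))]
    · rw [Finset.sum_congr rfl (g := fun _ => (1 : ℝ≥0∞))]
      · refine le_antisymm ?_ ?_
        · refine (iInf₂_le (Nat.find hex + 1)
            ⟨Nat.succ_pos _, Nat.find_spec hex⟩).trans ?_
          simp
        · refine le_iInf₂ fun t ht => ?_
          obtain ⟨k, rfl⟩ : ∃ k, t = k + 1 := ⟨t - 1, by omega⟩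
          have := Nat.find_min' hex ht.2
          simp only [Finset.sum_const, Finset.card_range, nsmul_eq_mul, mul_one]
          exact_mod_cast Nat.succ_le_succ this
      · intro n hn
        rw [if_neg (by have := Finset.mem_range.1 hn; omega), ENNReal.ofReal_one]
    · intro n hn
      rw [if_pos (by have := mt Finset.mem_range.2 hn; omega), ENNReal.ofReal_zero]
  · push Not at hex
    have h1 : returnTime s ω = ⊤ := by
      simp only [returnTime, iInf_eq_top]
      rintro t ⟨ht, hts⟩
      obtain ⟨k, rfl⟩ : ∃ k, t = k + 1 := ⟨t - 1, by omega⟩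
      exact absurd hts (hex k)
    rw [h1]
    simp [hex]

end ReturnTime

/-! ### The expected recurrence time as a sum of avoidance probabilities -/

section RecurrenceTime

theorem dependsOn_prod_avoid {S : Type*} [DecidableEq S] (s : S) (n : ℕ) :
    DependsOn (fun x : ℕ → S => ∏ k ∈ Finset.range n, if x (k + 1) = s then (0 : ℝ) else 1)
      (Set.Iic n) := by
  intro x y hxy
  refine Finset.prod_congr rfl fun k hk => ?_
  rw [hxy (k + 1) (Finset.mem_range.1 hk)]

variable {S A : Type*} [Fintype S] [MeasurableSpace S] [MeasurableSingletonClass S]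
  [Fintype A] [MeasurableSpace A] [MeasurableSingletonClass A] [DecidableEq S]

/-- The Markov property trades one factor of the path product for one step of the recursion of
`survival`. The case `m = 0` identifies the tail probabilities of the return time. -/
theorem stateExp_prod_avoid_mul (M : MDP S A) (π : Policy S A) (ν : PMF S) (s : S) (n m : ℕ) :
    M.stateExp π ν (fun x => (∏ k ∈ Finset.range n, if x (k + 1) = s then (0 : ℝ) else 1) *
      survival (M.transProb π) s m (x n)) =
    ∑ y, (ν y).toReal * survival (M.transProb π) s (n + m) y := by
  induction n generalizing m with
  | zero =>
    simp only [Finset.range_zero, Finset.prod_empty, one_mul, Nat.zero_add]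
    exact M.stateExp_zero_apply π ν _
  | succ n ih =>
    rw [show n + 1 + m = n + (m + 1) by ring, ← ih (m + 1)]
    simp only [survival]
    rw [← M.stateExp_mul_succ π ν (dependsOn_prod_avoid s n)
      (fun y => if y = s then 0 else survival (M.transProb π) s m y)]
    congr 1
    ext x
    rw [Finset.prod_range_succ]
    split_ifs <;> simp

theorem expectedRecurrenceTime_eq_tsum (M : MDP S A) (π : Policy S A) (s : S) :
    M.expectedRecurrenceTime π s =
      ∑' n, ENNReal.ofReal (survival (M.transProb π) s n s) := by
  simp only [expectedRecurrenceTime, returnTime_eq_tsum]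
  have hint := fun n => M.integrable_of_dependsOn π (PMF.pure s) (dependsOn_prod_avoid s n)
  rw [lintegral_tsum fun n => (hint n).aemeasurable.ennreal_ofReal]
  refine tsum_congr fun n => ?_
  rw [← ofReal_integral_eq_lintegral_ofReal (hint n) (ae_of_all _ fun ω =>
    Finset.prod_nonneg fun k _ => by split_ifs <;> norm_num)]
  congr 1
  have := M.stateExp_prod_avoid_mul π (PMF.pure s) s n 0
  simp only [survival, mul_one, Nat.add_zero] at this
  refine this.trans ?_
  rw [Finset.sum_eq_single s]
  · simp
  · intro y _ hy
    simp [PMF.pure_apply, hy]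
  · simp

theorem IsPositiveRecurrent.summable_survival {M : MDP S A} {π : Policy S A} {s : S}
    (hs : M.IsPositiveRecurrent π s) : Summable fun n => survival (M.transProb π) s n s := by
  have h := hs
  rw [IsPositiveRecurrent, expectedRecurrenceTime_eq_tsum] at h
  have := ENNReal.summable_toReal h.ne
  refine this.congr fun n => ?_
  rw [ENNReal.toReal_ofReal (survival_nonneg (M.transProb_nonneg π) s n s)]

theorem toReal_expectedRecurrenceTime (M : MDP S A) (π : Policy S A) (s : S) :
    (M.expectedRecurrenceTime π s).toReal = ∑' n, survival (M.transProb π) s n s := by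
  rw [expectedRecurrenceTime_eq_tsum, ENNReal.tsum_toReal_eq fun _ => ENNReal.ofReal_ne_top]
  refine tsum_congr fun n => ?_
  rw [ENNReal.toReal_ofReal (survival_nonneg (M.transProb_nonneg π) s n s)]

end RecurrenceTime

/-! ### Visit counts and the compensated process -/

section VisitCount

variable {S : Type*} [DecidableEq S]

/-- The indicator of a visit to `s` at time `t`, as a function of the state sequence. -/
def vis (s : S) (t : ℕ) (x : ℕ → S) : ℝ := if x t = s then 1 else 0

/-- The number of visits to `s` at the times `t, …, t + n - 1`. -/
def visCount (s : S) (t n : ℕ) (x : ℕ → S) : ℝ := ∑ k ∈ Finset.range n, vis s (t + k) x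

theorem vis_nonneg (s : S) (t : ℕ) (x : ℕ → S) : 0 ≤ vis s t x := by
  unfold vis
  split_ifs <;> norm_num

theorem vis_le_one (s : S) (t : ℕ) (x : ℕ → S) : vis s t x ≤ 1 := by
  unfold vis
  split_ifs <;> norm_num

theorem visCount_nonneg (s : S) (t n : ℕ) (x : ℕ → S) : 0 ≤ visCount s t n x :=
  Finset.sum_nonneg fun _ _ => vis_nonneg _ _ _

theorem visCount_le (s : S) (t n : ℕ) (x : ℕ → S) : visCount s t n x ≤ n := by
  have := Finset.sum_le_sum fun k (_ : k ∈ Finset.range n) => vis_le_one s (t + k) x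
  simpa [visCount] using this

theorem visCount_succ (s : S) (t n : ℕ) (x : ℕ → S) :
    visCount s t (n + 1) x = visCount s t n x + vis s (t + n) x :=
  Finset.sum_range_succ _ _

theorem visCount_zero_add (s : S) (t n : ℕ) (x : ℕ → S) :
    visCount s 0 (t + n) x = visCount s 0 t x + visCount s t n x := by
  simp [visCount, Finset.sum_range_add]

theorem one_le_visCount {s : S} {t n : ℕ} {x : ℕ → S} (hx : x t = s) (hn : 1 ≤ n) :
    1 ≤ visCount s t n x := by
  have h1 : vis s (t + 0) x ≤ visCount s t n x :=
    Finset.single_le_sum (f := fun k => vis s (t + k) x)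
      (fun k _ => vis_nonneg s (t + k) x) (Finset.mem_range.2 (show 0 < n by omega))
  have h2 : vis s (t + 0) x = 1 := if_pos hx
  rwa [h2] at h1

theorem dependsOn_vis (s : S) {t m : ℕ} (h : t ≤ m) : DependsOn (vis s t) (Set.Iic m) := by
  intro x y hxy
  rw [vis, vis, hxy t h]

theorem dependsOn_visCount (s : S) {t n m : ℕ} (h : t + n ≤ m + 1) :
    DependsOn (visCount s t n) (Set.Iic m) := by
  intro x y hxy
  refine Finset.sum_congr rfl fun k hk => dependsOn_vis s ?_ hxy
  have := Finset.mem_range.1 hk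
  omega

theorem dependsOn_comp_apply {S α : Type*} (g : S → α) {t m : ℕ} (h : t ≤ m) :
    DependsOn (fun x : ℕ → S => g (x t)) (Set.Iic m) := fun x y hxy => by
  simp only [hxy t h]

/-- The process `h(S_{t + n}) + n - L N`, where `N` counts the visits to `s` at the times
`t, …, t + n - 1`; a martingale in `n` if `h` solves the Poisson equation. -/
def compensated (s : S) (L : ℝ) (h : S → ℝ) (t n : ℕ) (x : ℕ → S) : ℝ :=
  h (x (t + n)) + n - L * visCount s t n x

theorem dependsOn_compensated (s : S) (L : ℝ) (h : S → ℝ) {t n m : ℕ} (hm : t + n ≤ m) :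
    DependsOn (compensated s L h t n) (Set.Iic m) := fun x y hxy => by
  simp only [compensated, hxy (t + n) hm, dependsOn_visCount s (by omega : t + n ≤ m + 1) hxy]

end VisitCount

/-! ### Second moment and exponential moment bounds -/

section Potential

variable {S A : Type*} [Fintype S] [MeasurableSpace S] [MeasurableSingletonClass S]
  [Fintype A] [MeasurableSpace A] [MeasurableSingletonClass A] [DecidableEq S]
  {M : MDP S A} {π : Policy S A} {s : S} {L : ℝ} {R : Set S} {h : S → ℝ}

/-- `R` contains `s` and is absorbing: each transition out of `R` has probability zero. -/
theorem IsReturnPotential.ae_mem (hpot : IsReturnPotential (M.transProb π) s L R h) (ν : PMF S)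
    (t n : ℕ) : ∀ᵐ ω ∂(M.trajLaw π ν), (ω t).1 = s → (ω (t + n)).1 ∈ R := by
  classical
  induction n with
  | zero =>
    refine ae_of_all _ fun ω hω => ?_
    rw [Nat.add_zero, hω]
    exact hpot.mem
  | succ n ih =>
    let F : (ℕ → S) → ℝ := fun x => if x (t + n) ∈ R then 1 else 0
    let g : S → ℝ := fun y => if y ∈ R then 0 else 1
    have hF : DependsOn F (Set.Iic (t + n)) :=
      dependsOn_comp_apply (fun y => if y ∈ R then (1 : ℝ) else 0) le_rfl
    have hFg : DependsOn (fun x => F x * g (x (t + n + 1))) (Set.Iic (t + n + 1)) := by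
      intro x y hxy
      simp only [F, g, hxy (t + n) (by simp), hxy (t + n + 1) (by simp)]
    have h0 : M.stateExp π ν (fun x => F x * g (x (t + n + 1))) = 0 := by
      rw [M.stateExp_mul_succ π ν hF g]
      have : (fun x : ℕ → S => F x * ∑ y, M.transProb π (x (t + n)) y * g y) =
          fun _ => 0 := by
        ext x
        by_cases hx : x (t + n) ∈ R
        · rw [Finset.sum_eq_zero, mul_zero]
          intro y _
          by_cases hy : M.transProb π (x (t + n)) y = 0
          · rw [hy, zero_mul]
          · simp [g, hpot.closed _ hx y hy]
        · simp [F, hx]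
      rw [this, M.stateExp_const]
    have hnn : ∀ x : ℕ → S, 0 ≤ F x * g (x (t + n + 1)) := by
      intro x
      simp only [F, g]
      split_ifs <;> norm_num
    have h1 := (integral_eq_zero_iff_of_nonneg (μ := M.trajLaw π ν)
      (f := fun ω => F (fun j => (ω j).1) * g (ω (t + n + 1)).1) (fun ω => hnn fun j => (ω j).1)
      (M.integrable_of_dependsOn π ν hFg)).1 h0
    filter_upwards [ih, h1] with ω hω1 hω2 hωs
    by_contra hcon
    rw [← Nat.add_assoc] at hcon
    have h3 : (if (ω (t + n)).1 ∈ R then (1 : ℝ) else 0) *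
      (if (ω (t + n + 1)).1 ∈ R then 0 else 1) = 0 := hω2
    rw [if_pos (hω1 hωs), if_neg hcon] at h3
    norm_num at h3

/-- The factor `vis s t` restricts to paths through `s` at time `t`. These almost surely stay in
`R`, so an identity for one transition is needed only on `R`. -/
theorem IsReturnPotential.stateExp_vis_mul_succ
    (hpot : IsReturnPotential (M.transProb π) s L R h) (ν : PMF S) {t n : ℕ}
    {φ : (ℕ → S) → ℝ} (hφ : DependsOn φ (Set.Iic (t + n))) {g g' : S → ℝ}
    (hg : ∀ x ∈ R, ∑ y, M.transProb π x y * g y = g' x) :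
    M.stateExp π ν (fun x => vis s t x * φ x * g (x (t + (n + 1)))) =
      M.stateExp π ν (fun x => vis s t x * φ x * g' (x (t + n))) := by
  have hF : DependsOn (fun x => vis s t x * φ x) (Set.Iic (t + n)) := fun x y hxy => by
    simp only [hφ hxy, dependsOn_vis s (Nat.le_add_right t n) hxy]
  rw [← Nat.add_assoc, M.stateExp_mul_succ π ν hF g]
  refine integral_congr_ae ?_
  filter_upwards [hpot.ae_mem ν t n] with ω hω
  by_cases hs : (ω t).1 = s
  · simp only [hg _ (hω hs)]
  · simp [vis, hs]

/-- Martingale increments are orthogonal and here bounded by `H + 1 + L`, so each step adds at most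
`(H + 1 + L) ^ 2` to the second moment. The process starts at `0`, because `h s = 0`. -/
theorem IsReturnPotential.stateExp_compensated_sq_le
    (hpot : IsReturnPotential (M.transProb π) s L R h) (ν : PMF S) {H : ℝ}
    (hH : ∀ y, h y ≤ H) (t n : ℕ) :
    M.stateExp π ν (fun x => vis s t x * compensated s L h t n x ^ 2) ≤
      (H + 1 + L) ^ 2 * n := by
  have hL := hpot.one_le
  have hH0 : 0 ≤ H := (hpot.nonneg s).trans (hH s)
  induction n with
  | zero =>
    have : (fun x : ℕ → S => vis s t x * compensated s L h t 0 x ^ 2) = fun _ => 0 := by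
      ext x
      by_cases hx : x t = s
      · simp [compensated, visCount, hx, hpot.apply_self]
      · simp [vis, hx]
    rw [this, M.stateExp_const]
    simp
  | succ n ih =>
    let D := compensated s L h t
    let g' : S → ℝ := fun y => h y - 1 + L * (if y = s then 1 else 0)
    have hstep := hpot.stateExp_vis_mul_succ ν
      (dependsOn_compensated s L h (le_refl (t + n))) (g := h) (g' := g') hpot.poisson
    have dA : DependsOn (fun x => vis s t x * D n x * h (x (t + (n + 1))))
        (Set.Iic (t + (n + 1))) := fun x y hxy => by
      simp only [D, dependsOn_vis s (by omega : t ≤ t + (n + 1)) hxy,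
        dependsOn_compensated s L h (by omega : t + n ≤ t + (n + 1)) hxy, 
        hxy (t + (n + 1)) (by simp)]
    have dB : DependsOn (fun x => vis s t x * D n x * g' (x (t + n)))
        (Set.Iic (t + (n + 1))) := fun x y hxy => by
      simp only [D, dependsOn_vis s (by omega : t ≤ t + (n + 1)) hxy,
        dependsOn_compensated s L h (by omega : t + n ≤ t + (n + 1)) hxy,
        hxy (t + n) (by simp)]
    have dC : DependsOn (fun x => vis s t x * D n x ^ 2) (Set.Iic (t + (n + 1))) :=
      fun x y hxy => by
        simp only [D, dependsOn_vis s (by omega : t ≤ t + (n + 1)) hxy,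
          dependsOn_compensated s L h (by omega : t + n ≤ t + (n + 1)) hxy]
    have dD : DependsOn (fun x => vis s t x * D (n + 1) x ^ 2) (Set.Iic (t + (n + 1))) :=
      fun x y hxy => by
        simp only [D, dependsOn_vis s (by omega : t ≤ t + (n + 1)) hxy,
          dependsOn_compensated s L h le_rfl hxy]
    have dE : DependsOn (fun _ : ℕ → S => (H + 1 + L) ^ 2) (Set.Iic (t + (n + 1))) :=
      fun _ _ _ => rfl
    have dF : DependsOn (fun x => vis s t x * D n x ^ 2 + (H + 1 + L) ^ 2)
        (Set.Iic (t + (n + 1))) := fun x y hxy => by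
      have := dC hxy
      simp only at this ⊢
      rw [this]
    have dG : DependsOn (fun x => 2 * (vis s t x * D n x * h (x (t + (n + 1))) -
        vis s t x * D n x * g' (x (t + n)))) (Set.Iic (t + (n + 1))) := fun x y hxy => by
      have h1 := dA hxy
      have h2 := dB hxy
      simp only at h1 h2 ⊢
      rw [h1, h2]
    have dFG : DependsOn (fun x => (vis s t x * D n x ^ 2 + (H + 1 + L) ^ 2) +
        2 * (vis s t x * D n x * h (x (t + (n + 1))) -
        vis s t x * D n x * g' (x (t + n)))) (Set.Iic (t + (n + 1))) := fun x y hxy => by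
      have h1 := dF hxy
      have h2 := dG hxy
      simp only at h1 h2 ⊢
      rw [h1, h2]
    refine (M.stateExp_mono π ν dD dFG fun x => ?_).trans ?_
    · have hD : D (n + 1) x = D n x + (h (x (t + (n + 1))) - g' (x (t + n))) := by
        simp only [D, g', compensated, visCount_succ, vis]
        push_cast
        ring
      have hv0 := vis_nonneg s t x
      have hv1 := vis_le_one s t x
      have hΔ : (h (x (t + (n + 1))) - g' (x (t + n))) ^ 2 ≤ (H + 1 + L) ^ 2 := by
        have a1 := hpot.nonneg (x (t + (n + 1)))
        have a2 := hpot.nonneg (x (t + n))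
        have a3 := hH (x (t + (n + 1)))
        have a4 := hH (x (t + n))
        apply sq_le_sq'
        · simp only [g']
          split_ifs <;> linarith
        · simp only [g']
          split_ifs <;> linarith
      have hvΔ := (mul_le_of_le_one_left
        (sq_nonneg (h (x (t + (n + 1))) - g' (x (t + n)))) hv1).trans hΔ
      rw [hD]
      linarith
    · rw [M.stateExp_add π ν dF dG, M.stateExp_add π ν dC dE, M.stateExp_const_mul,
        M.stateExp_sub π ν dA dB, M.stateExp_const, hstep]
      push_cast
      linarith

/-- The Poisson equation gives `P (1 + h) = h + L 1_s` on `R`. Away from `s` this is at most `r (1 +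
h)` by `hhr`; at `s` the discount `exp (-β)` of the visit brings the value `L` down to `r`. Each
step therefore contracts by the factor `r`. -/
theorem IsReturnPotential.stateExp_exp_visCount_le
    (hpot : IsReturnPotential (M.transProb π) s L R h) (ν : PMF S) {r β : ℝ} (hr : 0 ≤ r)
    (hhr : ∀ y, h y ≤ r * (1 + h y)) (hβ : L * Real.exp (-β) ≤ r) (t n : ℕ) :
    M.stateExp π ν (fun x => vis s t x * Real.exp (-β * visCount s t n x) *
      (1 + h (x (t + n)))) ≤ r ^ n := by
  induction n with
  | zero =>
    have d1 : DependsOn (vis s t) (Set.Iic t) := dependsOn_vis s le_rfl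
    have : (fun x : ℕ → S => vis s t x * Real.exp (-β * visCount s t 0 x) *
        (1 + h (x (t + 0)))) = vis s t := by
      ext x
      by_cases hx : x t = s
      · simp [visCount, hx, hpot.apply_self]
      · simp [vis, hx]
    rw [this, pow_zero]
    refine (M.stateExp_mono π ν d1 (fun _ _ _ => rfl) (vis_le_one s t)).trans ?_
    exact (M.stateExp_const π ν 1).le
  | succ n ih =>
    have hφ : DependsOn (fun x => Real.exp (-β * visCount s t (n + 1) x)) (Set.Iic (t + n)) :=
      fun x y hxy => by
        simp only [dependsOn_visCount s (by omega : t + (n + 1) ≤ t + n + 1) hxy]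
    have hstep := hpot.stateExp_vis_mul_succ ν hφ (g := fun y => 1 + h y)
      (g' := fun y => h y + L * (if y = s then 1 else 0)) (fun x hx => by
        simp only [mul_add, Finset.sum_add_distrib, mul_one, M.sum_transProb]
        rw [hpot.poisson x hx]
        simp only [mul_ite, mul_one, mul_zero]
        ring)
    rw [hstep, pow_succ']
    refine le_trans ?_ (mul_le_mul_of_nonneg_left ih hr)
    rw [← M.stateExp_const_mul]
    refine M.stateExp_mono π ν (n := t + n) ?_ ?_ fun x => ?_
    · intro x y hxy
      simp only [dependsOn_vis s (by omega : t ≤ t + n) hxy, hxy (t + n) (by simp),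
        dependsOn_visCount s (by omega : t + (n + 1) ≤ t + n + 1) hxy]
    · intro x y hxy
      simp only [dependsOn_vis s (by omega : t ≤ t + n) hxy, hxy (t + n) (by simp),
        dependsOn_visCount s (by omega : t + n ≤ t + n + 1) hxy]
    · rw [visCount_succ, mul_add (-β), Real.exp_add]
      have hw : 0 ≤ vis s t x * Real.exp (-β * visCount s t n x) :=
        mul_nonneg (vis_nonneg s t x) (Real.exp_pos _).le
      have key : Real.exp (-β * vis s (t + n) x) *
          (h (x (t + n)) + L * (if x (t + n) = s then 1 else 0)) ≤ r * (1 + h (x (t + n))) := by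
        by_cases hx : x (t + n) = s
        · simp only [vis, hx, hpot.apply_self, if_true, mul_one]
          linarith
        · simpa [vis, hx] using hhr (x (t + n))
      calc _ = (vis s t x * Real.exp (-β * visCount s t n x)) *
            (Real.exp (-β * vis s (t + n) x) *
              (h (x (t + n)) + L * (if x (t + n) = s then 1 else 0))) := by ring
        _ ≤ (vis s t x * Real.exp (-β * visCount s t n x)) * (r * (1 + h (x (t + n)))) :=
            mul_le_mul_of_nonneg_left key hw
        _ = _ := by ring

end Potential

/-- A deterministic bound of the distance from the inverse frequency `(t + n) / (J + N)` to `L`. -/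
theorem abs_div_sub_le {n t J N L D y H β θ : ℝ} (hn : 1 ≤ n) (ht : 0 ≤ t) (hJ0 : 0 ≤ J)
    (hJ : J ≤ t) (hN1 : 1 ≤ N) (hNn : N ≤ n) (hL : 1 ≤ L) (hy0 : 0 ≤ y) (hy : y ≤ H)
    (hD : D = y + n - L * N) (hβ : 0 < β) (hθ : 0 < θ) :
    |(t + n) / (J + N) - L| ≤
      2 * β / θ / n * (D ^ 2 / (2 * √n) + √n / 2 + H + t * (1 + L)) +
      (n + t) * (1 + L) * Real.exp (θ * n / 2) * Real.exp (-β * N) := by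
  have hK : 0 < J + N := by linarith
  have hsq : 0 < √n := Real.sqrt_pos.2 (by linarith)
  have hLN : 0 ≤ L * N := by positivity
  have hLJ : 0 ≤ L * J := by positivity
  have hLJt : L * J ≤ L * t := mul_le_mul_of_nonneg_left hJ (by linarith)
  have hLNn : L * N ≤ L * n := mul_le_mul_of_nonneg_left hNn (by linarith)
  -- The weighted inequality of arithmetic and geometric means, balanced so that a second moment of
  -- order `n` produces a bound of order `√n`.
  have hDabs : |D| ≤ D ^ 2 / (2 * √n) + √n / 2 := by
    have h1 : D ^ 2 / (2 * √n) + √n / 2 - |D| = (|D| - √n) ^ 2 / (2 * √n) := by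
      rw [← sq_abs D]
      field_simp
      ring
    have h2 : 0 ≤ (|D| - √n) ^ 2 / (2 * √n) := by positivity
    linarith
  have hnum1 : |t + n - L * (J + N)| ≤ D ^ 2 / (2 * √n) + √n / 2 + H + t * (1 + L) := by
    refine le_trans ?_ (add_le_add_left (add_le_add_left hDabs H) _)
    have e : t + n - L * (J + N) = D - y + (t - L * J) := by rw [hD]; ring
    rw [e, abs_le]
    constructor
    · linarith [neg_abs_le D]
    · linarith [le_abs_self D]
  have hnum2 : |t + n - L * (J + N)| ≤ (n + t) * (1 + L) := by
    rw [abs_le]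
    constructor
    · linarith
    · linarith [mul_nonneg (by linarith : 0 ≤ n + t) (by linarith : 0 ≤ L)]
  have hdiv : |(t + n) / (J + N) - L| ≤ |t + n - L * (J + N)| / N := by
    have e : (t + n) / (J + N) - L = (t + n - L * (J + N)) / (J + N) := by
      field_simp
    rw [e, abs_div, abs_of_pos hK]
    exact div_le_div_of_nonneg_left (abs_nonneg _) (by linarith) (by linarith)
  have hnn1 : 0 ≤ D ^ 2 / (2 * √n) + √n / 2 + H + t * (1 + L) := (abs_nonneg _).trans hnum1
  have hnn2 : 0 ≤ (n + t) * (1 + L) := (abs_nonneg _).trans hnum2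
  -- With many visits, `1 / N` is at most `2 β / (θ n)`. With few visits, the crude bound is
  -- multiplied by an exponential that is at least `1`.
  rcases le_total (θ * n / 2) (β * N) with hc | hc
  · have hinv : N⁻¹ ≤ 2 * β / θ / n := by
      rw [inv_le_iff_one_le_mul₀ (by linarith), div_div, div_mul_eq_mul_div,
        le_div_iff₀ (by positivity)]
      linarith
    have : |t + n - L * (J + N)| / N ≤
        2 * β / θ / n * (D ^ 2 / (2 * √n) + √n / 2 + H + t * (1 + L)) := by
      rw [div_eq_inv_mul]
      exact mul_le_mul hinv hnum1 (abs_nonneg _) (by positivity)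
    have h3 : 0 ≤ (n + t) * (1 + L) * Real.exp (θ * n / 2) * Real.exp (-β * N) := by positivity
    linarith
  · have hexp : 1 ≤ Real.exp (θ * n / 2) * Real.exp (-β * N) := by
      rw [← Real.exp_add]
      exact Real.one_le_exp (by linarith)
    have h1 : |t + n - L * (J + N)| / N ≤ (n + t) * (1 + L) :=
      (div_le_self (abs_nonneg _) hN1).trans hnum2
    have h2 : (n + t) * (1 + L) ≤
        (n + t) * (1 + L) * (Real.exp (θ * n / 2) * Real.exp (-β * N)) :=
      le_mul_of_one_le_right hnn2 hexp
    have h3 : 0 ≤ 2 * β / θ / n * (D ^ 2 / (2 * √n) + √n / 2 + H + t * (1 + L)) :=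
      mul_nonneg (by positivity) hnn1
    linarith

/-! ### Convergence in mean of the inverse visit frequency -/

section Frequency

variable {S A : Type*} [Fintype S] [MeasurableSpace S] [MeasurableSingletonClass S]
  [Fintype A] [MeasurableSpace A] [MeasurableSingletonClass A] [DecidableEq S]
  {M : MDP S A} {π : Policy S A} {s : S} {L : ℝ} {R : Set S} {h : S → ℝ}

theorem IsReturnPotential.abs_stateExp_vis_mul_div_sub_le
    (hpot : IsReturnPotential (M.transProb π) s L R h) (ν : PMF S) {H β θ : ℝ}
    (hH : ∀ y, h y ≤ H) (hβ : 0 < β) (hθ : 0 < θ)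
    (hhθ : ∀ y, h y ≤ Real.exp (-θ) * (1 + h y)) (hβθ : L * Real.exp (-β) ≤ Real.exp (-θ))
    (t : ℕ) {n : ℕ} (hn : 1 ≤ n) :
    |M.stateExp π ν (fun x => vis s t x * ((t + n : ℕ) / visCount s 0 (t + n) x)) -
        L * M.stateExp π ν (vis s t)| ≤
      2 * β / θ / n * ((H + 1 + L) ^ 2 * √n / 2 + √n / 2 + H + t * (1 + L)) +
      (n + t) * (1 + L) * Real.exp (-θ / 2) ^ n := by
  have hL := hpot.one_le
  have hH0 : 0 ≤ H := (hpot.nonneg s).trans (hH s)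
  have hn' : (1 : ℝ) ≤ n := by exact_mod_cast hn
  have hsq : 0 < √(n : ℝ) := Real.sqrt_pos.2 (by linarith)
  set a : ℝ := 2 * β / θ / n with ha
  set b : ℝ := √(n : ℝ) / 2 + H + t * (1 + L) with hb
  set c : ℝ := (n + t) * (1 + L) * Real.exp (θ * n / 2) with hc
  have ha0 : 0 ≤ a := by positivity
  have hb0 : 0 ≤ b := by positivity
  have hc0 : 0 ≤ c := by positivity
  have dV : DependsOn (vis s t) (Set.Iic (t + n)) := dependsOn_vis s (Nat.le_add_right _ _)
  have dK : DependsOn (visCount s 0 (t + n)) (Set.Iic (t + n)) := dependsOn_visCount s (by omega)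
  have dN : DependsOn (visCount s t n) (Set.Iic (t + n)) := dependsOn_visCount s (by omega)
  have dD : DependsOn (compensated s L h t n) (Set.Iic (t + n)) :=
    dependsOn_compensated s L h le_rfl
  have d1 : DependsOn (fun x => vis s t x * ((t + n : ℕ) / visCount s 0 (t + n) x))
      (Set.Iic (t + n)) := fun x y hxy => by simp only [dV hxy, dK hxy]
  have d2 : DependsOn (fun x => L * vis s t x) (Set.Iic (t + n)) :=
    fun x y hxy => by simp only [dV hxy]
  have d3 : DependsOn (fun x => vis s t x * compensated s L h t n x ^ 2) (Set.Iic (t + n)) :=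
    fun x y hxy => by simp only [dV hxy, dD hxy]
  have d4 : DependsOn (fun x => a / (2 * √n) * (vis s t x * compensated s L h t n x ^ 2))
      (Set.Iic (t + n)) := fun x y hxy => by simp only [dV hxy, dD hxy]
  have d5 : DependsOn (fun x => vis s t x * Real.exp (-β * visCount s t n x) *
      (1 + h (x (t + n)))) (Set.Iic (t + n)) :=
    fun x y hxy => by simp only [dV hxy, dN hxy, hxy (t + n) (by simp)]
  have d6 : DependsOn (fun x => c * (vis s t x * Real.exp (-β * visCount s t n x) *
      (1 + h (x (t + n))))) (Set.Iic (t + n)) :=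
    fun x y hxy => by simp only [dV hxy, dN hxy, hxy (t + n) (by simp)]
  have d7 : DependsOn (fun x => a / (2 * √n) * (vis s t x * compensated s L h t n x ^ 2) + a * b)
      (Set.Iic (t + n)) := fun x y hxy => by simp only [dV hxy, dD hxy]
  have hE : |M.stateExp π ν (fun x => vis s t x * ((t + n : ℕ) / visCount s 0 (t + n) x)) -
        L * M.stateExp π ν (vis s t)| ≤
      M.stateExp π ν (fun x => (a / (2 * √n) * (vis s t x * compensated s L h t n x ^ 2) + a * b)
        + c * (vis s t x * Real.exp (-β * visCount s t n x) * (1 + h (x (t + n))))) := by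
    rw [← M.stateExp_const_mul, ← M.stateExp_sub π ν d1 d2]
    refine abs_integral_le_integral_abs.trans ?_
    refine M.stateExp_mono π ν (n := t + n)
      (F := fun x => |vis s t x * ((t + n : ℕ) / visCount s 0 (t + n) x) - L * vis s t x|)
      (fun x y hxy => ?_) (fun x y hxy => ?_) fun x => ?_
    · simp only [dV hxy, dK hxy]
    · simp only [dV hxy, dD hxy, dN hxy, hxy (t + n) (by simp)]
    · by_cases hx : x t = s
      · have hv : vis s t x = 1 := if_pos hx
        have hy0 := hpot.nonneg (x (t + n))
        have key := abs_div_sub_le hn' (Nat.cast_nonneg t) (visCount_nonneg s 0 t x)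
          (visCount_le s 0 t x) (one_le_visCount hx hn) (visCount_le s t n x) hL
          hy0 (hH _) (rfl : compensated s L h t n x = _) hβ hθ
        simp only [hv, one_mul, mul_one]
        rw [visCount_zero_add, Nat.cast_add]
        -- The factor `1 + h ≥ 1` is inserted to match the Lyapunov estimate.
        have h5 : c * Real.exp (-β * visCount s t n x) ≤
            c * (Real.exp (-β * visCount s t n x) * (1 + h (x (t + n)))) :=
          mul_le_mul_of_nonneg_left
            (le_mul_of_one_le_right (Real.exp_pos _).le (by linarith)) hc0
        have h6 : a * (compensated s L h t n x ^ 2 / (2 * √n) + √n / 2 + H + t * (1 + L)) =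
            a / (2 * √n) * compensated s L h t n x ^ 2 + a * b := by
          rw [hb]
          ring
        linarith
      · have hv : vis s t x = 0 := if_neg hx
        simp only [hv, zero_mul, mul_zero, sub_zero, abs_zero, zero_add, add_zero]
        positivity
  refine hE.trans ?_
  rw [M.stateExp_add π ν d7 d6, M.stateExp_add π ν d4 (fun _ _ _ => rfl), M.stateExp_const,
    M.stateExp_const_mul, M.stateExp_const_mul]
  have b1 := mul_le_mul_of_nonneg_left (hpot.stateExp_compensated_sq_le ν hH t n)
    (by positivity : 0 ≤ a / (2 * √n))
  have b2 := mul_le_mul_of_nonneg_left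
    (hpot.stateExp_exp_visCount_le ν (Real.exp_pos _).le hhθ hβθ t n) hc0
  have e1 : a / (2 * √n) * ((H + 1 + L) ^ 2 * n) = a * ((H + 1 + L) ^ 2 * √n / 2) := by
    have : (n : ℝ) = √n * √n := (Real.mul_self_sqrt (by linarith)).symm
    rw [show (H + 1 + L) ^ 2 * (n : ℝ) = (H + 1 + L) ^ 2 * (√n * √n) by rw [← this]]
    field_simp
  -- The threshold costs `exp (θ n / 2)` against a decay of `exp (-θ n)`, which leaves half the
  -- rate.
  have e2 : c * Real.exp (-θ) ^ n = (n + t) * (1 + L) * Real.exp (-θ / 2) ^ n := by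
    rw [hc, mul_assoc, ← Real.exp_nat_mul, ← Real.exp_nat_mul, ← Real.exp_add]
    congr 2
    ring
  rw [e1] at b1
  rw [e2] at b2
  rw [hb] at *
  linarith

/-- On visits to `s` at time `t`, the inverse frequency of the visits up to time `t + n` converges
in mean to the expected return time, at a rate that is linear in `t`. -/
theorem IsReturnPotential.exists_rate
    (hpot : IsReturnPotential (M.transProb π) s L R h) (ν : PMF S) :
    ∃ E : ℕ → ℝ, Tendsto E atTop (𝓝 0) ∧ ∀ t n : ℕ, 1 ≤ n →
      |M.stateExp π ν (fun x => vis s t x * ((t + n : ℕ) / visCount s 0 (t + n) x)) -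
        L * M.stateExp π ν (vis s t)| ≤ (1 + t) * E n := by
  obtain ⟨H, hH1, hH⟩ : ∃ H, 1 ≤ H ∧ ∀ y, h y ≤ H :=
    ⟨1 + ∑ y, h y, by linarith [Finset.sum_nonneg fun y (_ : y ∈ Finset.univ) => hpot.nonneg y],
      fun y => by
        linarith [Finset.single_le_sum (fun z _ => hpot.nonneg z) (Finset.mem_univ y)]⟩
  have hL := hpot.one_le
  -- For this `r`, the condition `h ≤ r (1 + h)` is equivalent to `h ≤ H`. Then `θ` and `β` are
  -- chosen so that `exp (-θ) = r` and `L exp (-β) = r`.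
  set r : ℝ := H / (1 + H) with hr
  have hr0 : 0 < r := by positivity
  have hr1 : r < 1 := by
    rw [hr, div_lt_one (by linarith)]
    linarith
  set θ : ℝ := -Real.log r with hθdef
  set β : ℝ := Real.log (L / r) with hβdef
  have hθ : 0 < θ := neg_pos.2 (Real.log_neg hr0 hr1)
  have hβ : 0 < β := Real.log_pos (by
    rw [lt_div_iff₀ hr0]
    linarith)
  have hexpθ : Real.exp (-θ) = r := by rw [hθdef, neg_neg, Real.exp_log hr0]
  have hexpβ : L * Real.exp (-β) = r := by
    rw [hβdef, Real.exp_neg, Real.exp_log (by positivity)]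
    field_simp
  have hhθ : ∀ y, h y ≤ Real.exp (-θ) * (1 + h y) := fun y => by
    rw [hexpθ, hr, div_mul_eq_mul_div, le_div_iff₀ (by linarith)]
    linarith [hH y]
  have hρ1 : Real.exp (-θ / 2) < 1 := Real.exp_lt_one_iff.2 (by linarith)
  set ρ : ℝ := Real.exp (-θ / 2) with hρ
  have hρ0 : 0 ≤ ρ := (Real.exp_pos _).le
  refine ⟨fun n => 2 * β / θ * (((H + 1 + L) ^ 2 / 2 + 1 / 2) * (√(n : ℝ))⁻¹ +
    (H + (1 + L)) * (n : ℝ)⁻¹) + (1 + L) * (n * ρ ^ n + ρ ^ n), ?_, fun t n hn => ?_⟩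
  · have t1 : Tendsto (fun n : ℕ => (√(n : ℝ))⁻¹) atTop (𝓝 0) :=
      tendsto_inv_atTop_zero.comp (Real.tendsto_sqrt_atTop.comp tendsto_natCast_atTop_atTop)
    have t2 : Tendsto (fun n : ℕ => (n : ℝ)⁻¹) atTop (𝓝 0) := tendsto_inv_atTop_nhds_zero_nat
    have t3 : Tendsto (fun n : ℕ => (n : ℝ) * ρ ^ n) atTop (𝓝 0) :=
      tendsto_self_mul_const_pow_of_lt_one hρ0 hρ1
    have t4 : Tendsto (fun n : ℕ => ρ ^ n) atTop (𝓝 0) := tendsto_pow_atTop_nhds_zero_of_lt_one hρ0 hρ1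
    have := (((t1.const_mul ((H + 1 + L) ^ 2 / 2 + 1 / 2)).add
      (t2.const_mul (H + (1 + L)))).const_mul (2 * β / θ)).add ((t3.add t4).const_mul (1 + L))
    simpa using this
  · refine (hpot.abs_stateExp_vis_mul_div_sub_le ν hH hβ hθ hhθ (by rw [hexpθ, hexpβ]) t hn).trans
      ?_
    have hn' : (1 : ℝ) ≤ n := by exact_mod_cast hn
    have hsq : 0 < √(n : ℝ) := Real.sqrt_pos.2 (by linarith)
    have ht : (0 : ℝ) ≤ t := Nat.cast_nonneg t
    have e1 : √(n : ℝ) / n = (√(n : ℝ))⁻¹ := by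
      rw [Real.sqrt_div_self]
    have p1 : 0 ≤ t * (2 * β / θ * (((H + 1 + L) ^ 2 / 2 + 1 / 2) * (√(n : ℝ))⁻¹ +
        H * (n : ℝ)⁻¹)) := by positivity
    have p2 : 0 ≤ 2 * β / θ * ((1 + L) * (n : ℝ)⁻¹) := by positivity
    have p3 : 0 ≤ (1 + L) * (t * (n * ρ ^ n) + ρ ^ n) := by positivity
    have e2 : 2 * β / θ / n * ((H + 1 + L) ^ 2 * √n / 2 + √n / 2 + H + t * (1 + L)) =
        2 * β / θ * (((H + 1 + L) ^ 2 / 2 + 1 / 2) * (√(n : ℝ))⁻¹ +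
        H * (n : ℝ)⁻¹) + 2 * β / θ * (t * (1 + L) * (n : ℝ)⁻¹) := by
      rw [← e1]
      field_simp
    rw [e2]
    simp only [← hρ]
    linarith

end Frequency

/-! ### Uniqueness of the discounted stationary distribution -/

section DiscountedStationary

variable {S A : Type*} [Fintype S] [Fintype A]

theorem IsDiscountedStationary.eq_add {M : MDP S A} {π : Policy S A} {d : S → ℝ}
    (hd : M.IsDiscountedStationary π d) (y : S) :
    d y = M.γ * ∑ x, d x * M.transProb π x y + (1 - M.γ) * (M.ρ y).toReal := by
  rw [← hd.stationary y]
  simp only [mul_add, Finset.sum_add_distrib]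
  rw [← Finset.sum_mul, hd.sum_eq_one, one_mul, Finset.mul_sum]
  congr 1
  exact Finset.sum_congr rfl fun x _ => by ring

/-- The difference of two solutions is fixed by `γ P`, which contracts the `ℓ¹` norm by the factor
`γ < 1`. -/
theorem IsDiscountedStationary.unique {M : MDP S A} {π : Policy S A} {d d' : S → ℝ}
    (hd : M.IsDiscountedStationary π d) (hd' : M.IsDiscountedStationary π d') : d = d' := by
  have h1 : ∀ y, |d y - d' y| ≤ M.γ * ∑ x, |d x - d' x| * M.transProb π x y := fun y => by
    have e : d y - d' y = M.γ * ∑ x, (d x - d' x) * M.transProb π x y := by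
      rw [hd.eq_add y, hd'.eq_add y]
      simp only [sub_mul, Finset.sum_sub_distrib]
      ring
    rw [e, abs_mul, abs_of_pos M.γ_pos]
    refine mul_le_mul_of_nonneg_left ((Finset.abs_sum_le_sum_abs _ _).trans_eq ?_) M.γ_pos.le
    exact Finset.sum_congr rfl fun x _ => by
      rw [abs_mul, abs_of_nonneg (M.transProb_nonneg π x y)]
  have h2 : ∑ y, |d y - d' y| ≤ M.γ * ∑ x, |d x - d' x| := by
    refine (Finset.sum_le_sum fun y _ => h1 y).trans_eq ?_
    rw [← Finset.mul_sum, Finset.sum_comm]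
    simp only [← Finset.mul_sum, M.sum_transProb, mul_one]
  have h3 : 0 ≤ ∑ y, |d y - d' y| := Finset.sum_nonneg fun _ _ => abs_nonneg _
  have h4 : ∑ y, |d y - d' y| = 0 := by
    have : 0 ≤ (1 - M.γ) * ∑ y, |d y - d' y| := mul_nonneg (by linarith [M.γ_lt_one]) h3
    have : (1 - M.γ) * ∑ y, |d y - d' y| = 0 := by linarith
    exact (mul_eq_zero.1 this).resolve_left (by linarith [M.γ_lt_one])
  ext y
  have := (Finset.sum_eq_zero_iff_of_nonneg fun _ _ => abs_nonneg _).1 h4 y (Finset.mem_univ y)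
  exact sub_eq_zero.1 (abs_eq_zero.1 this)

theorem IsDiscountedStationary.le_one {M : MDP S A} {π : Policy S A} {d : S → ℝ}
    (hd : M.IsDiscountedStationary π d) (y : S) : d y ≤ 1 := by
  rw [← hd.sum_eq_one]
  exact Finset.single_le_sum (fun x _ => hd.nonneg x) (Finset.mem_univ y)

end DiscountedStationary

/-! ### Occupation measure and the limit of the averaging correction -/

section Correction

variable {S A : Type*} [Fintype S] [MeasurableSpace S] [MeasurableSingletonClass S]
  [Fintype A] [MeasurableSpace A] [MeasurableSingletonClass A] [DecidableEq S]

theorem stateExp_vis_nonneg (M : MDP S A) (π : Policy S A) (ν : PMF S) (y : S) (t : ℕ) :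
    0 ≤ M.stateExp π ν (vis y t) :=
  M.stateExp_nonneg π ν (vis_nonneg y t)

theorem stateExp_vis_le_one (M : MDP S A) (π : Policy S A) (ν : PMF S) (y : S) (t : ℕ) :
    M.stateExp π ν (vis y t) ≤ 1 :=
  (M.stateExp_mono π ν (n := t) (dependsOn_vis y le_rfl) (fun _ _ _ => rfl)
    (vis_le_one y t)).trans_eq (M.stateExp_const π ν 1)

theorem stateExp_vis_zero (M : MDP S A) (π : Policy S A) (ν : PMF S) (y : S) :
    M.stateExp π ν (vis y 0) = (ν y).toReal := by
  refine (M.stateExp_zero_apply π ν fun z => if z = y then 1 else 0).trans ?_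
  simp

theorem stateExp_vis_succ (M : MDP S A) (π : Policy S A) (ν : PMF S) (y : S) (t : ℕ) :
    M.stateExp π ν (vis y (t + 1)) =
      ∑ x, M.stateExp π ν (vis x t) * M.transProb π x y := by
  have h1 := M.stateExp_mul_succ π ν (F := fun _ => 1) (n := t) (fun _ _ _ => rfl)
    (fun z => if z = y then 1 else 0)
  simp only [one_mul, mul_ite, mul_one, mul_zero, Finset.sum_ite_eq', Finset.mem_univ,
    if_true] at h1
  refine h1.trans ?_
  have h2 : (fun x : ℕ → S => M.transProb π (x t) y) =
      fun x => ∑ z, M.transProb π z y * vis z t x := by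
    ext x
    simp [vis]
  rw [h2, M.stateExp_sum π ν Finset.univ (n := t)]
  · exact Finset.sum_congr rfl fun z _ => by rw [M.stateExp_const_mul, mul_comm]
  · intro z _ x x' hx
    simp only [dependsOn_vis z (le_refl t) hx]

theorem sum_stateExp_vis (M : MDP S A) (π : Policy S A) (ν : PMF S) (t : ℕ) :
    ∑ y, M.stateExp π ν (vis y t) = 1 := by
  rw [← M.stateExp_sum π ν Finset.univ (n := t) fun y _ => dependsOn_vis y le_rfl]
  simp [vis, M.stateExp_const]

theorem summable_discounted_vis (M : MDP S A) (π : Policy S A) (ν : PMF S) (y : S) :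
    Summable fun t => M.γ ^ t * M.stateExp π ν (vis y t) :=
  Summable.of_nonneg_of_le
    (fun t => mul_nonneg (pow_nonneg M.γ_pos.le t) (M.stateExp_vis_nonneg π ν y t))
    (fun t => mul_le_of_le_one_right (pow_nonneg M.γ_pos.le t) (M.stateExp_vis_le_one π ν y t))
    (summable_geometric_of_lt_one M.γ_pos.le M.γ_lt_one)

/-- The discounted occupation probabilities form a discounted stationary distribution. -/
theorem isDiscountedStationary_tsum (M : MDP S A) (π : Policy S A) :
    M.IsDiscountedStationary π
      (fun y => (1 - M.γ) * ∑' t, M.γ ^ t * M.stateExp π M.ρ (vis y t)) := by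
  have hγ : 0 < 1 - M.γ := by linarith [M.γ_lt_one]
  have hsum : ∑ y, (1 - M.γ) * ∑' t, M.γ ^ t * M.stateExp π M.ρ (vis y t) = 1 := by
    rw [← Finset.mul_sum, ← Summable.tsum_finsetSum fun y _ => M.summable_discounted_vis π M.ρ y]
    simp only [← Finset.mul_sum, M.sum_stateExp_vis, mul_one]
    rw [tsum_geometric_of_lt_one M.γ_pos.le M.γ_lt_one, mul_inv_cancel₀ hγ.ne']
  refine ⟨fun y => mul_nonneg hγ.le (tsum_nonneg fun t =>
    mul_nonneg (pow_nonneg M.γ_pos.le t) (M.stateExp_vis_nonneg π M.ρ y t)), hsum, fun y => ?_⟩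
  simp only [mul_add, Finset.sum_add_distrib]
  -- The term `t = 0` of the occupation series is the `ρ` part; the shifted remainder is one
  -- transition of the whole series.
  rw [← Finset.sum_mul, hsum, one_mul, (M.summable_discounted_vis π M.ρ y).tsum_eq_zero_add,
    pow_zero, one_mul, stateExp_vis_zero, mul_add, add_comm]
  congr 1
  have h1 : ∀ x, (1 - M.γ) * (∑' t, M.γ ^ t * M.stateExp π M.ρ (vis x t)) *
      (M.γ * M.transProb π x y) =
      (1 - M.γ) * ∑' t, M.γ ^ t * M.stateExp π M.ρ (vis x t) * (M.γ * M.transProb π x y) :=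
    fun x => by rw [mul_assoc, tsum_mul_right]
  simp only [h1]
  rw [← Finset.mul_sum, ← Summable.tsum_finsetSum fun x _ =>
    (M.summable_discounted_vis π M.ρ x).mul_right _]
  congr 1
  refine tsum_congr fun t => ?_
  rw [stateExp_vis_succ, Finset.mul_sum]
  exact Finset.sum_congr rfl fun x _ => by ring

theorem averagingCorrection_eq_sum (M : MDP S A) (π : Policy S A) (T : ℕ) (s : S) :
    M.averagingCorrection π T s = (1 - M.γ) * ∑ t ∈ Finset.range T,
      M.γ ^ t * M.stateExp π M.ρ (fun x => vis s t x * (T / visCount s 0 T x)) := by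
  have hv : ∀ t (ω : ℕ → S × A), visit s t ω = vis s t fun j => (ω j).1 := fun t ω => by
    by_cases h : (ω t).1 = s <;> simp [visit, vis, h]
  have h1 : M.averagingCorrection π T s = M.stateExp π M.ρ (fun x =>
      (1 - M.γ) * ∑ t ∈ Finset.range T, M.γ ^ t * (vis s t x * (T / visCount s 0 T x))) := by
    refine integral_congr_ae (ae_of_all _ fun ω => ?_)
    simp only [trajAverage, hv, visCount, Nat.zero_add]
    rw [mul_assoc]
    congr 1
    rw [mul_div_assoc', mul_comm, mul_div_assoc, Finset.sum_mul]
    exact Finset.sum_congr rfl fun t _ => by ring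
  rw [h1, M.stateExp_const_mul, M.stateExp_sum π M.ρ (Finset.range T) (n := T)]
  · simp only [M.stateExp_const_mul]
  · intro t ht x y hxy
    have := Finset.mem_range.1 ht
    simp only [dependsOn_vis s this.le hxy, dependsOn_visCount s (by omega : 0 + T ≤ T + 1) hxy]

/-- Dominated convergence for series in `t`: for fixed `t` the rate applies with `n = T - t`, and
its growth in `t` is only linear, hence summable against `γ ^ t`. -/
theorem IsReturnPotential.tendsto_averagingCorrection {M : MDP S A} {π : Policy S A} {s : S}
    {L : ℝ} {R : Set S} {h : S → ℝ} (hpot : IsReturnPotential (M.transProb π) s L R h) :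
    Tendsto (fun T => M.averagingCorrection π T s) atTop
      (𝓝 (L * ((1 - M.γ) * ∑' t, M.γ ^ t * M.stateExp π M.ρ (vis s t)))) := by
  obtain ⟨E, hE, hrate⟩ := hpot.exists_rate M.ρ
  obtain ⟨B, hB⟩ : ∃ B, ∀ n, E n ≤ B := by
    obtain ⟨B, hB⟩ := hE.bddAbove_range
    exact ⟨B, fun n => hB ⟨n, rfl⟩⟩
  have hL := hpot.one_le
  let a : ℕ → ℕ → ℝ := fun T t =>
    M.stateExp π M.ρ (fun x => vis s t x * (T / visCount s 0 T x))
  -- Extending by zero beyond the horizon turns the finite sums into series over one index set.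
  let f : ℕ → ℕ → ℝ := fun T t => if t < T then M.γ ^ t * a T t else 0
  have hbound : ∀ T t, t < T → |a T t - L * M.stateExp π M.ρ (vis s t)| ≤ (1 + t) * E (T - t) := by
    intro T t htT
    have := hrate t (T - t) (by omega)
    rwa [Nat.add_sub_cancel' htT.le] at this
  have hlim : ∀ t, Tendsto (fun T => f T t) atTop
      (𝓝 (M.γ ^ t * (L * M.stateExp π M.ρ (vis s t)))) := by
    intro t
    have h1 : Tendsto (fun T => a T t) atTop (𝓝 (L * M.stateExp π M.ρ (vis s t))) := by
      rw [tendsto_iff_norm_sub_tendsto_zero]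
      have h2 : Tendsto (fun T => (1 + (t : ℝ)) * E (T - t)) atTop (𝓝 0) := by
        simpa using (hE.comp (tendsto_sub_atTop_nat t)).const_mul (1 + (t : ℝ))
      refine squeeze_zero' (Eventually.of_forall fun _ => norm_nonneg _) ?_ h2
      filter_upwards [eventually_gt_atTop t] with T hT
      exact hbound T t hT
    refine (h1.const_mul (M.γ ^ t)).congr' ?_
    filter_upwards [eventually_gt_atTop t] with T hT
    simp [f, hT]
  have hdom : ∀ T t, ‖f T t‖ ≤ M.γ ^ t * (L + (1 + t) * |B|) := by
    intro T t
    have hγ := pow_nonneg M.γ_pos.le t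
    have ht : (0 : ℝ) ≤ t := Nat.cast_nonneg t
    by_cases htT : t < T
    · simp only [f, htT, if_true, Real.norm_eq_abs, abs_mul, abs_of_nonneg hγ]
      refine mul_le_mul_of_nonneg_left ?_ hγ
      have h1 := (hbound T t htT).trans
        (mul_le_mul_of_nonneg_left ((hB (T - t)).trans (le_abs_self B)) (by positivity))
      have h2 : |L * M.stateExp π M.ρ (vis s t)| ≤ L := by
        rw [abs_of_nonneg (mul_nonneg (by linarith) (M.stateExp_vis_nonneg π M.ρ s t))]
        exact mul_le_of_le_one_right (by linarith) (M.stateExp_vis_le_one π M.ρ s t)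
      have h3 := abs_sub_abs_le_abs_sub (a T t) (L * M.stateExp π M.ρ (vis s t))
      linarith
    · simp only [f, htT, if_false, norm_zero]
      positivity
  have hsummable : Summable fun t : ℕ => M.γ ^ t * (L + (1 + t) * |B|) := by
    have hn : ‖M.γ‖ < 1 := by
      rw [Real.norm_eq_abs, abs_of_pos M.γ_pos]
      exact M.γ_lt_one
    have s1 := summable_pow_mul_geometric_of_norm_lt_one 1 hn
    have s0 := summable_geometric_of_lt_one M.γ_pos.le M.γ_lt_one
    refine ((s0.mul_left (L + |B|)).add (s1.mul_left |B|)).congr fun t => ?_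
    rw [pow_one]
    ring
  have hmain := tendsto_tsum_of_dominated_convergence (𝓕 := atTop) hsummable hlim
    (Eventually.of_forall fun T t => hdom T t)
  have e1 : ∀ T, M.averagingCorrection π T s = (1 - M.γ) * ∑' t, f T t := fun T => by
    rw [averagingCorrection_eq_sum, tsum_eq_sum (s := Finset.range T)]
    · congr 1
      exact Finset.sum_congr rfl fun t ht => (if_pos (Finset.mem_range.1 ht)).symm
    · intro t ht
      exact if_neg (mt Finset.mem_range.2 ht)
  have e2 : L * ((1 - M.γ) * ∑' t, M.γ ^ t * M.stateExp π M.ρ (vis s t)) =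
      (1 - M.γ) * ∑' t, M.γ ^ t * (L * M.stateExp π M.ρ (vis s t)) := by
    simp only [mul_left_comm _ L]
    rw [tsum_mul_left]
    ring
  rw [e2]
  exact (hmain.const_mul _).congr fun T => (e1 T).symm

end Correction

end MDP

theorem mainTheorem2 {S A : Type*}
    [Fintype S] [MeasurableSpace S] [MeasurableSingletonClass S]
    [Fintype A] [MeasurableSpace A] [MeasurableSingletonClass A]
    (M : MDP S A) (π : Policy S A) (s : S) (hs : M.IsPositiveRecurrent π s) :
    (∃! d : S → ℝ, M.IsDiscountedStationary π d) ∧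
    ∀ d : S → ℝ, M.IsDiscountedStationary π d →
      ∃ c : ℝ, Tendsto (fun T : ℕ => M.averagingCorrection π T s) atTop (𝓝 c) ∧
        c = (M.expectedRecurrenceTime π s).toReal * d s ∧
        c ≤ (M.expectedRecurrenceTime π s).toReal ∧
        M.expectedRecurrenceTime π s < ∞ := by
  classical
  have hd₀ := M.isDiscountedStationary_tsum π
  refine ⟨⟨_, hd₀, fun d hd => hd.unique hd₀⟩, fun d hd => ?_⟩
  refine ⟨(M.expectedRecurrenceTime π s).toReal * d s, ?_, rfl,
    mul_le_of_le_one_right ENNReal.toReal_nonneg (hd.le_one s), hs⟩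
  rw [hd.unique hd₀, M.toReal_expectedRecurrenceTime π s]
  exact (MDP.isReturnPotential_tsum_survival (M.transProb_nonneg π)
    hs.summable_survival).tendsto_averagingCorrection
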